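/- Let $G$ be a virtually abelian group (that is, $G$ has an abelian subgroup of finite index) and let $S\subseteq G$ be a finite set that generates $G$ as a monoid. Let $\omega\colon S\to\{1,2,3,\dots\}$ be any function, and for $g\in G$ put $$\omega(g)=\min\Bigl\{\sum_{i=1}^k\omega(s_i)\;\Bigm|\;k\ge 0,\ s_1,\dots,s_k\in S,\ s_1s_2\cdots s_k=g\Bigr\}.$$ Let $H$ be any subgroup of $G$ and, for $n\ge 0$, let $\sigma(n)=\#\{h\in H\mid \omega(h)=n\}$, which is finite. Then the formal power series $\sum_{n\ge 0}\sigma(n)z^n$ (the weighted growth series of $H$ relative to $G$) is a rational function: there are polynomials $p,q\in\mathbb{Z}[z]$ with $q\neq 0$ such that $$\sum_{n\ge 0}\sigma(n)z^n=\frac{p(z)}{q(z)}.$$ -/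

import Mathlib

namespace RelGrowth

/-- A group is virtually abelian if it has an abelian subgroup of finite index. -/
def IsVirtuallyAbelian (G : Type*) [Group G] : Prop :=
  ∃ A : Subgroup G, IsMulCommutative A ∧ A.FiniteIndex

/-- The element of `G` represented by a word over `S`. -/
def wordEval {G : Type*} [Group G] {S : Finset G} (w : List S) : G :=
  (w.map (fun s : S => (s : G))).prod

/-- The weight of a word: the sum of the weights of its letters. -/
def wordWeight {G : Type*} {S : Finset G} (ω : S → ℕ+) (w : List S) : ℕ :=
  (w.map (fun s : S => (ω s : ℕ))).sum

/-- The weight of an element: the minimal weight of a word representing it. If `S` generates `G`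
as a monoid, the infimum is attained, see `exists_word_weight`. -/
noncomputable def weight {G : Type*} [Group G] {S : Finset G} (ω : S → ℕ+) (g : G) : ℕ :=
  sInf {m : ℕ | ∃ w : List S, wordEval w = g ∧ wordWeight ω w = m}

/-- The weighted growth function of `H` relative to `G`: the number of elements of `H` of
weight `n` in `G`. The set counted is finite, see `finite_sphere`. -/
noncomputable def relGrowth {G : Type*} [Group G] {S : Finset G} (ω : S → ℕ+) (H : Subgroup G)
    (n : ℕ) : ℕ :=
  {g : G | g ∈ H ∧ weight ω g = n}.ncard

/-- The weighted growth series of `H` relative to `G`. -/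
noncomputable def relGrowthSeries {G : Type*} [Group G] {S : Finset G} (ω : S → ℕ+)
    (H : Subgroup G) : PowerSeries ℤ :=
  PowerSeries.mk fun n => (relGrowth ω H n : ℤ)

/-- A power series is a rational function if it equals `p / q` for integer polynomials `p`, `q`
with `q ≠ 0`. -/
def IsRationalSeries (F : PowerSeries ℤ) : Prop :=
  ∃ p q : Polynomial ℤ, q ≠ 0 ∧ (q : PowerSeries ℤ) * F = (p : PowerSeries ℤ)

theorem exists_word_weight {G : Type*} [Group G] {S : Finset G}
    (hS : Submonoid.closure (S : Set G) = ⊤) (ω : S → ℕ+) (g : G) :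
    ∃ w : List S, wordEval w = g ∧ wordWeight ω w = weight ω g := by
  have hne : {m : ℕ | ∃ w : List S, wordEval w = g ∧ wordWeight ω w = m}.Nonempty := by
    have hg : g ∈ Submonoid.closure (S : Set G) := hS ▸ Submonoid.mem_top g
    obtain ⟨l, hl, rfl⟩ := Submonoid.exists_list_of_mem_closure hg
    refine ⟨_, l.attach.map (fun x => ⟨x.1, Finset.mem_coe.1 (hl x.1 x.2)⟩), ?_, rfl⟩
    simp only [wordEval, List.map_map, Function.comp_def]
    exact congrArg List.prod (List.attach_map_subtype_val l)
  exact Nat.sInf_mem hne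

theorem length_le_wordWeight {G : Type*} {S : Finset G} (ω : S → ℕ+) (w : List S) :
    w.length ≤ wordWeight ω w := by
  induction w with
  | nil => simp
  | cons s w ih =>
    have := (ω s).pos
    simp only [wordWeight, List.map_cons, List.sum_cons, List.length_cons] at ih ⊢
    omega

theorem finite_sphere {G : Type*} [Group G] {S : Finset G}
    (hS : Submonoid.closure (S : Set G) = ⊤) (ω : S → ℕ+) (H : Subgroup G) (n : ℕ) :
    {g : G | g ∈ H ∧ weight ω g = n}.Finite := by
  refine ((List.finite_length_le S n).image wordEval).subset ?_
  rintro g ⟨-, hg⟩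
  obtain ⟨w, hw, hw'⟩ := exists_word_weight hS ω g
  exact ⟨w, by have := length_le_wordWeight ω w; simp only [Set.mem_ofPred_eq]; omega, hw⟩

end RelGrowth

/-!
Let `A` be an abelian subgroup of finite index. Reading a word while remembering only the coset of
its unread part is the work of a finite automaton, in which each letter contributes an element of
`A × ℕ`, namely a correction in `A` and its weight. As `A × ℕ` is commutative, Kleene's algorithm
shows that the contributions of the words with value in a given coset form a semilinear set. Hence
the graph of the weight function on the coset, which selects the minimal weights, is semilinear too,
and so is its restriction to `H`.

A semilinear set with finitely many elements of each degree has a rational generating series. Its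
linear pieces may be taken to be finite unions of translates of finitely generated submonoids of
positive degree; these sets are closed under intersection, so inclusion–exclusion reduces the claim
to a single one of them, which the Hilbert–Serre argument settles.
-/

namespace RelGrowth

open Set
open scoped Pointwise

namespace IsRationalSeries

variable {F F' : PowerSeries ℤ}

theorem coe_polynomial (p : Polynomial ℤ) : IsRationalSeries p :=
  ⟨p, 1, one_ne_zero, by simp⟩

theorem zero : IsRationalSeries 0 := by
  simpa using coe_polynomial 0

theorem add (hF : IsRationalSeries F) (hF' : IsRationalSeries F') :
    IsRationalSeries (F + F') := by
  obtain ⟨p, q, hq, h⟩ := hF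
  obtain ⟨p', q', hq', h'⟩ := hF'
  refine ⟨q' * p + q * p', q * q', mul_ne_zero hq hq', ?_⟩
  push_cast
  rw [← h, ← h']
  ring

theorem polynomial_mul (r : Polynomial ℤ) (hF : IsRationalSeries F) :
    IsRationalSeries (r * F) := by
  obtain ⟨p, q, hq, h⟩ := hF
  refine ⟨r * p, q, hq, ?_⟩
  push_cast
  rw [← h]
  ring

theorem of_polynomial_mul {r : Polynomial ℤ} (hr : r ≠ 0) (h : IsRationalSeries (r * F)) :
    IsRationalSeries F := by
  obtain ⟨p, q, hq, h⟩ := h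
  refine ⟨p, q * r, mul_ne_zero hq hr, ?_⟩
  push_cast
  rw [← h]
  ring

theorem sub (hF : IsRationalSeries F) (hF' : IsRationalSeries F') :
    IsRationalSeries (F - F') := by
  simpa [sub_eq_add_neg] using hF.add (hF'.polynomial_mul (-1))

theorem X_pow_mul (c : ℕ) (hF : IsRationalSeries F) :
    IsRationalSeries (PowerSeries.X ^ c * F) := by
  simpa using hF.polynomial_mul (Polynomial.X ^ c)

theorem of_eq_add_X_pow_mul {c : ℕ} (hc : c ≠ 0) (hF' : IsRationalSeries F')
    (h : F = F' + PowerSeries.X ^ c * F) : IsRationalSeries F := by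
  have hne : (1 - Polynomial.X ^ c : Polynomial ℤ) ≠ 0 := fun h0 => by
    simpa [hc] using congrArg (Polynomial.eval 0) h0
  refine of_polynomial_mul hne ?_
  have hmul : ((1 - Polynomial.X ^ c : Polynomial ℤ) : PowerSeries ℤ) * F = F' := by
    push_cast
    linear_combination h
  rwa [hmul]

theorem of_forall_eq_add_X_pow_mul {F F' : ℕ → PowerSeries ℤ} {c J : ℕ} (hc : c ≠ 0)
    (hF' : ∀ k, IsRationalSeries (F' k)) (h : ∀ k, F k = F' k + PowerSeries.X ^ c * F (k + 1))
    (hJ : F (J + 1) = F J) : IsRationalSeries (F 0) := by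
  have hFJ : IsRationalSeries (F J) := of_eq_add_X_pow_mul hc (hF' J) (by rw [← hJ, ← h J, hJ])
  clear hJ
  induction J with
  | zero => exact hFJ
  | succ J ih => exact ih (h J ▸ (hF' J).add (hFJ.X_pow_mul c))

end IsRationalSeries

section DegSeries

variable {α β : Type*} {deg : α → ℕ} {s t : Set α}

/-- The generating series counting the elements of a set by their degree. It is meaningful only
for graded-finite sets, since an infinite fibre contributes the junk coefficient `0`. -/
noncomputable def degSeries (deg : α → ℕ) (s : Set α) : PowerSeries ℤ :=
  PowerSeries.mk fun n => ({x ∈ s | deg x = n}.ncard : ℤ)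

/-- A set is graded-finite if it has finitely many elements of each degree, so that it has a
generating series. -/
def GradedFinite (deg : α → ℕ) (s : Set α) : Prop :=
  ∀ n, {x ∈ s | deg x = n}.Finite

theorem GradedFinite.mono (ht : GradedFinite deg t) (hst : s ⊆ t) : GradedFinite deg s :=
  fun n => (ht n).subset fun _ hx => ⟨hst hx.1, hx.2⟩

theorem GradedFinite.of_injOn {deg' : β → ℕ} {f : α → β} {u : Set β} (hu : GradedFinite deg' u)
    (hf : InjOn f s) (hmaps : MapsTo f s u) (hdeg : ∀ x ∈ s, deg' (f x) = deg x) :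
    GradedFinite deg s := fun n =>
  .of_injOn (fun x hx => (⟨hmaps hx.1, (hdeg x hx.1).trans hx.2⟩ : f x ∈ {y ∈ u | deg' y = n}))
    (hf.mono fun _ hx => hx.1) (hu n)

@[simp]
theorem degSeries_empty (deg : α → ℕ) : degSeries deg ∅ = 0 := by
  ext n
  simp [degSeries]

theorem degSeries_singleton (deg : α → ℕ) (a : α) :
    degSeries deg {a} = PowerSeries.X ^ deg a := by
  ext n
  rw [degSeries, PowerSeries.coeff_mk, PowerSeries.coeff_X_pow]
  split_ifs with h
  · have hfib : {x ∈ ({a} : Set α) | deg x = n} = {a} := by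
      ext x
      simp only [mem_singleton_iff, mem_ofPred_eq, and_iff_left_iff_imp]
      rintro rfl
      exact h.symm
    rw [hfib]
    simp
  · have hfib : {x ∈ ({a} : Set α) | deg x = n} = ∅ := by
      ext x
      simp only [mem_singleton_iff, mem_ofPred_eq, mem_empty_iff_false, iff_false, not_and]
      rintro rfl h'
      exact h h'.symm
    rw [hfib]
    simp

theorem degSeries_union_add_inter (hs : GradedFinite deg s) (ht : GradedFinite deg t) :
    degSeries deg (s ∪ t) + degSeries deg (s ∩ t) = degSeries deg s + degSeries deg t := by
  ext n
  have hunion : {x ∈ s ∪ t | deg x = n} = {x ∈ s | deg x = n} ∪ {x ∈ t | deg x = n} :=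
    union_inter_distrib_right s t _
  have hinter : {x ∈ s ∩ t | deg x = n} = {x ∈ s | deg x = n} ∩ {x ∈ t | deg x = n} :=
    inter_inter_distrib_right s t _
  simp only [degSeries, map_add, PowerSeries.coeff_mk, hunion, hinter]
  exact_mod_cast ncard_union_add_ncard_inter _ _ (hs n) (ht n)

theorem degSeries_union (hs : GradedFinite deg s) (ht : GradedFinite deg t)
    (hst : Disjoint s t) : degSeries deg (s ∪ t) = degSeries deg s + degSeries deg t := by
  rw [← degSeries_union_add_inter hs ht, hst.inter_eq, degSeries_empty, add_zero]

theorem degSeries_image {deg' : β → ℕ} {f : α → β} (c : ℕ) (hf : InjOn f s)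
    (hdeg : ∀ x ∈ s, deg' (f x) = c + deg x) :
    degSeries deg' (f '' s) = PowerSeries.X ^ c * degSeries deg s := by
  ext n
  rw [PowerSeries.coeff_X_pow_mul', degSeries, degSeries, PowerSeries.coeff_mk,
    PowerSeries.coeff_mk]
  split_ifs with h
  · have hfib : {y ∈ f '' s | deg' y = n} = f '' {x ∈ s | deg x = n - c} := by
      ext y
      constructor
      · rintro ⟨⟨x, hx, rfl⟩, hn⟩
        exact ⟨x, ⟨hx, by have := hdeg x hx; omega⟩, rfl⟩
      · rintro ⟨x, ⟨hx, hn⟩, rfl⟩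
        exact ⟨⟨x, hx, rfl⟩, by have := hdeg x hx; omega⟩
    rw [hfib, (hf.mono fun x hx => hx.1).ncard_image]
  · have hfib : {y ∈ f '' s | deg' y = n} = ∅ := by
      refine eq_empty_iff_forall_notMem.2 ?_
      rintro _ ⟨⟨x, hx, rfl⟩, hn⟩
      have := hdeg x hx
      omega
    rw [hfib]
    simp

theorem isRationalSeries_degSeries_of_finite (deg : α → ℕ) (hs : s.Finite) :
    IsRationalSeries (degSeries deg s) := by
  induction s, hs using Set.Finite.induction_on with
  | empty => simpa using IsRationalSeries.zero
  | @insert a s ha hs ih =>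
    rw [insert_eq, degSeries_union (fun _ => (finite_singleton a).subset fun _ hx => hx.1)
      (fun _ => hs.subset fun _ hx => hx.1) (disjoint_singleton_left.2 ha), degSeries_singleton]
    simpa using (IsRationalSeries.coe_polynomial (Polynomial.X ^ deg a)).add ih

theorem isRationalSeries_degSeries_of_forall_fiber {ι : Type*} [Finite ι] (f : α → ι)
    (hs : GradedFinite deg s) (hf : ∀ i, IsRationalSeries (degSeries deg {x ∈ s | f x = i})) :
    IsRationalSeries (degSeries deg s) := by
  suffices h : ∀ I : Set ι, IsRationalSeries (degSeries deg {x ∈ s | f x ∈ I}) by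
    simpa using h univ
  intro I
  induction I, I.toFinite using Set.Finite.induction_on with
  | empty => simpa using IsRationalSeries.zero
  | @insert i I hi _ ih =>
    have hsplit : {x ∈ s | f x ∈ insert i I} = {x ∈ s | f x = i} ∪ {x ∈ s | f x ∈ I} :=
      inter_union_distrib_left s _ _
    rw [hsplit, degSeries_union (hs.mono fun _ hx => hx.1) (hs.mono fun _ hx => hx.1)]
    · exact (hf i).add ih
    · exact Set.disjoint_left.2 fun x hx hx' => hi (hx.2 ▸ hx'.2)

/-- Inclusion–exclusion: a union of finitely many sets from a family closed under intersection
differs from the sum of their series only by series of unions of fewer members of the family. -/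
theorem isRationalSeries_degSeries_biUnion {ι : Type*} {C : Set (Set α)}
    (hC : ∀ s ∈ C, ∀ t ∈ C, s ∩ t ∈ C)
    (hrat : ∀ s ∈ C, GradedFinite deg s → IsRationalSeries (degSeries deg s))
    (I : Finset ι) {f : ι → Set α} (hf : ∀ i ∈ I, f i ∈ C)
    (hfin : GradedFinite deg (⋃ i ∈ I, f i)) :
    IsRationalSeries (degSeries deg (⋃ i ∈ I, f i)) := by
  classical
  induction I using Finset.induction_on generalizing f with
  | empty => simpa using IsRationalSeries.zero
  | insert a I _ ih =>
    simp only [Finset.mem_insert, forall_eq_or_imp] at hf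
    rw [Finset.set_biUnion_insert] at hfin ⊢
    have hfin₁ := hfin.mono subset_union_left
    have hfin₂ := hfin.mono subset_union_right
    have hfin₃ := hfin₁.mono (inter_subset_left (t := ⋃ i ∈ I, f i))
    rw [eq_sub_of_add_eq (degSeries_union_add_inter hfin₁ hfin₂)]
    rw [inter_iUnion₂] at hfin₃ ⊢
    exact ((hrat _ hf.1 hfin₁).add (ih hf.2 hfin₂)).sub
      (ih (fun i hi => hC _ hf.1 _ (hf.2 i hi)) hfin₃)

end DegSeries

section Translates

variable {M : Type*} [AddCommMonoid M]

/-- Dickson's lemma, for subsets of a finite union of translates of `Q`. -/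
theorem exists_finite_subset_add_of_subset_add {B U : Set M} {Q : AddSubmonoid M} (hB : B.Finite)
    (hQ : Q.FG) (hU : U ⊆ B + Q) : ∃ F ⊆ U, F.Finite ∧ U ⊆ F + Q := by
  obtain ⟨m, φ, rfl⟩ := AddSubmonoid.fg_iff_exists_fin_addMonoidHom.1 hQ
  let V (b : M) : Set (Fin m → ℕ) := {x | b + φ x ∈ U}
  have hmin (b : M) : {x | Minimal (· ∈ V b) x}.Finite :=
    WellQuasiOrderedLE.finite_of_isAntichain (setOfPred_minimal_antichain _)
  refine ⟨⋃ b ∈ B, (fun x => b + φ x) '' {x | Minimal (· ∈ V b) x}, ?_,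
    hB.biUnion fun b _ => (hmin b).image _, fun z hz => ?_⟩
  · simp only [iUnion_subset_iff, image_subset_iff]
    exact fun b _ x hx => hx.prop
  · obtain ⟨b, hb, _, ⟨x, rfl⟩, rfl⟩ := hU hz
    obtain ⟨y, hyx, hy⟩ := exists_minimal_le_of_wellFoundedLT (· ∈ V b) x hz
    obtain ⟨k, rfl⟩ := exists_add_of_le hyx
    exact ⟨b + φ y, mem_biUnion hb ⟨y, hy, rfl⟩, φ k, ⟨k, rfl⟩, by simp [add_assoc]⟩

theorem exists_forall_inter_subset_of_monotone {B : Set M} {Q : AddSubmonoid M} (hB : B.Finite)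
    (hQ : Q.FG) {T : ℕ → Set M} (hT : Monotone T) (hTQ : ∀ k, T k + Q ⊆ T k) :
    ∃ J, ∀ k, (B + (Q : Set M)) ∩ T k ⊆ T J := by
  obtain ⟨F, hFU, hF, hUF⟩ := exists_finite_subset_add_of_subset_add hB hQ
    (inter_subset_left : (B + (Q : Set M)) ∩ ⋃ k, T k ⊆ B + Q)
  have hex (x : M) (hx : x ∈ F) : ∃ k, x ∈ T k := mem_iUnion.1 (hFU hx).2
  choose! level hlevel using hex
  obtain ⟨J, hJ⟩ := (hF.image level).bddAbove
  have hFJ : F ⊆ T J := fun x hx => hT (hJ ⟨x, hx, rfl⟩) (hlevel x hx)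
  exact ⟨J, fun k => (inter_subset_inter_right _ (subset_iUnion T k)).trans
    (hUF.trans ((add_subset_add_right hFJ).trans (hTQ J)))⟩

theorem fg_inf [IsCancelAdd M] {Q Q' : AddSubmonoid M} (hQ : Q.FG) (hQ' : Q'.FG) :
    (Q ⊓ Q').FG := by
  obtain ⟨m, φ, rfl⟩ := AddSubmonoid.fg_iff_exists_fin_addMonoidHom.1 hQ
  obtain ⟨n, ψ, rfl⟩ := AddSubmonoid.fg_iff_exists_fin_addMonoidHom.1 hQ'
  let f : (Fin m → ℕ) × (Fin n → ℕ) →+ M := φ.comp (AddMonoidHom.fst _ _)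
  let g : (Fin m → ℕ) × (Fin n → ℕ) →+ M := ψ.comp (AddMonoidHom.snd _ _)
  convert (AddSubmonoid.fg_eqLocusM f g).map f using 1
  ext x
  constructor
  · rintro ⟨⟨y, rfl⟩, ⟨z, hz⟩⟩
    exact ⟨(y, z), hz.symm, rfl⟩
  · rintro ⟨p, hp, rfl⟩
    exact ⟨⟨p.1, rfl⟩, ⟨p.2, hp.symm⟩⟩

/-- By Dickson's lemma in `M × M`, the diagonal of `(B + Q) × (B' + Q')` is covered by finitely many
translates of `Q × Q'` based at diagonal points, and cancellation shrinks `Q × Q'` to the diagonal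
of `Q ∩ Q'`. -/
theorem exists_finite_add_inter_add_eq [IsCancelAdd M] {B B' : Set M} {Q Q' : AddSubmonoid M}
    (hB : B.Finite) (hB' : B'.Finite) (hQ : Q.FG) (hQ' : Q'.FG) :
    ∃ F : Set M, F.Finite ∧ (B + (Q : Set M)) ∩ (B' + Q') = F + (Q ⊓ Q' : AddSubmonoid M) := by
  let diag : M → M × M := fun x => (x, x)
  have hdiag : diag.Injective := fun _ _ h => congrArg Prod.fst h
  have hU : diag '' ((B + (Q : Set M)) ∩ (B' + Q')) ⊆ B ×ˢ B' + (Q.prod Q' : Set (M × M)) := by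
    rintro _ ⟨x, ⟨⟨b, hb, q, hq, hx⟩, ⟨b', hb', q', hq', hx'⟩⟩, rfl⟩
    exact ⟨(b, b'), ⟨hb, hb'⟩, (q, q'), ⟨hq, hq'⟩, Prod.ext hx hx'⟩
  obtain ⟨F, hFU, hF, hUF⟩ :=
    exists_finite_subset_add_of_subset_add (hB.prod hB') (hQ.prod hQ') hU
  refine ⟨diag ⁻¹' F, hF.preimage hdiag.injOn, Subset.antisymm (fun x hx => ?_) ?_⟩
  · obtain ⟨_, hy, ⟨q, q'⟩, ⟨hq, hq'⟩, h⟩ := hUF (mem_image_of_mem diag hx)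
    obtain ⟨y, -, rfl⟩ := hFU hy
    obtain ⟨h₁ : y + q = x, h₂ : y + q' = x⟩ := Prod.ext_iff.1 h
    obtain rfl : q = q' := add_left_cancel (h₁.trans h₂.symm)
    exact ⟨y, hy, q, ⟨hq, hq'⟩, h₁⟩
  · rintro _ ⟨y, hy, q, ⟨hq, hq'⟩, rfl⟩
    obtain ⟨x, ⟨⟨b, hb, p, hp, h⟩, ⟨b', hb', p', hp', h'⟩⟩, hx⟩ := hFU hy
    obtain rfl := hdiag hx
    exact ⟨⟨b, hb, p + q, add_mem hp hq, by simp only [← add_assoc, h]⟩,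
      ⟨b', hb', p' + q, add_mem hp' hq', by simp only [← add_assoc, h']⟩⟩

end Translates

section Rationality

variable {M : Type*} [AddCommMonoid M] {deg : M →+ ℕ}

theorem add_closure_subset_of_forall_add_mem {t T : Set M} (h : ∀ u ∈ t, ∀ x ∈ T, u + x ∈ T) :
    T + (AddSubmonoid.closure t : Set M) ⊆ T := by
  rintro _ ⟨x, hx, q, hq, rfl⟩
  change x + q ∈ T
  induction hq using AddSubmonoid.closure_induction_left with
  | zero => rwa [add_zero]
  | add_left u hu q _ ih => rw [add_left_comm]; exact h u hu _ ih

theorem add_closure_insert_eq (B t : Set M) (u : M) :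
    B + (AddSubmonoid.closure (insert u t) : Set M) = (B + (AddSubmonoid.closure t : Set M)) ∪
      (u +ᵥ (B + (AddSubmonoid.closure (insert u t) : Set M))) := by
  have hu : u ∈ AddSubmonoid.closure (insert u t) := AddSubmonoid.subset_closure (mem_insert u t)
  refine Subset.antisymm ?_ (union_subset ?_ ?_)
  · rintro _ ⟨b, hb, x, hx, rfl⟩
    obtain ⟨_, hy, q, hq, rfl⟩ := AddSubmonoid.mem_sup.1
      ((insert_eq u t ▸ AddSubmonoid.closure_union {u} t).le hx)
    obtain ⟨k, rfl⟩ := AddSubmonoid.mem_closure_singleton.1 hy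
    cases k with
    | zero => exact Or.inl ⟨b, hb, q, hq, by simp⟩
    | succ k =>
      have hq' := AddSubmonoid.closure_mono (subset_insert u t) hq
      refine Or.inr ⟨b + (k • u + q), ⟨b, hb, _, add_mem (nsmul_mem hu k) hq', rfl⟩, ?_⟩
      simp only [vadd_eq_add, succ_nsmul]
      abel
  · exact add_subset_add_left (AddSubmonoid.closure_mono (subset_insert u t))
  · rintro _ ⟨_, ⟨b, hb, x, hx, rfl⟩, rfl⟩
    exact ⟨b, hb, u + x, add_mem hu hx, add_left_comm b u x⟩

theorem degSeries_sdiff_eq_add_X_pow_mul [IsCancelAdd M] {P S T : Set M} {u : M}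
    (hS : S = P ∪ (u +ᵥ S)) (hfin : GradedFinite deg (S \ T)) :
    degSeries deg (S \ T) = degSeries deg (P \ (T ∪ (u +ᵥ S))) +
      PowerSeries.X ^ deg u * degSeries deg (S \ {x | u + x ∈ T}) := by
  have hsplit : S \ T = (P \ (T ∪ (u +ᵥ S))) ∪ (u + ·) '' (S \ {x | u + x ∈ T}) := by
    ext x
    constructor
    · rintro ⟨hxS, hxT⟩
      by_cases hxu : x ∈ u +ᵥ S
      · obtain ⟨y, hy, rfl⟩ := hxu
        exact Or.inr ⟨y, ⟨hy, hxT⟩, rfl⟩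
      · rw [hS] at hxS
        exact Or.inl ⟨hxS.resolve_right hxu, fun h => h.elim hxT hxu⟩
    · rintro (⟨hxP, hx⟩ | ⟨y, ⟨hyS, hyT⟩, rfl⟩)
      · exact ⟨hS ▸ Or.inl hxP, fun h => hx (Or.inl h)⟩
      · exact ⟨hS ▸ Or.inr ⟨y, hyS, rfl⟩, hyT⟩
  rw [← degSeries_image (deg u) (add_right_injective u).injOn fun x _ => map_add deg u x]
  conv_lhs => rw [hsplit]
  refine degSeries_union (hfin.mono ?_) (hfin.mono ?_) ?_
  · exact hsplit ▸ subset_union_left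
  · exact hsplit ▸ subset_union_right
  · refine Set.disjoint_left.2 ?_
    rintro _ ⟨-, hx⟩ ⟨y, hy, rfl⟩
    exact hx (Or.inr ⟨y, hy.1, rfl⟩)

theorem exists_sdiff_colon_succ_eq {B t T : Set M} (hB : B.Finite) (ht : t.Finite)
    (hT : ∀ u ∈ t, ∀ x ∈ T, u + x ∈ T) {u : M} (hu : u ∈ t) :
    ∃ J : ℕ, (B + (AddSubmonoid.closure t : Set M)) \ {x | (J + 1) • u + x ∈ T} =
      (B + (AddSubmonoid.closure t : Set M)) \ {x | J • u + x ∈ T} := by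
  have hmono : Monotone fun k : ℕ => {x | k • u + x ∈ T} :=
    monotone_nat_of_le_succ fun k x hx => by
      simpa only [mem_ofPred_eq, succ_nsmul', add_assoc] using hT u hu _ hx
  obtain ⟨J, hJ⟩ := exists_forall_inter_subset_of_monotone hB
    ((AddSubmonoid.fg_iff _).2 ⟨t, rfl, ht⟩) hmono fun k =>
      add_closure_subset_of_forall_add_mem fun v hv x hx => by
        simpa only [mem_ofPred_eq, add_left_comm] using hT v hv _ hx
  exact ⟨J, Subset.antisymm (sdiff_subset_sdiff_right (hmono J.le_succ))
    fun x hx => ⟨hx.1, fun h => hx.2 (hJ (J + 1) ⟨hx.1, h⟩)⟩⟩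

/-- The Hilbert–Serre argument for monoids: peeling off one generator `u` expresses the series of
`(B + closure t) \ T` through one with fewer generators and that of `(B + closure t) \ (T - u)`,
and by Dickson's lemma the sets `T - k • u` stabilise as `k` grows. -/
theorem isRationalSeries_degSeries_add_closure_sdiff [IsCancelAdd M] {B t T : Set M}
    (hB : B.Finite) (ht : t.Finite) (hpos : ∀ u ∈ t, deg u ≠ 0)
    (hT : ∀ u ∈ t, ∀ x ∈ T, u + x ∈ T)
    (hfin : GradedFinite deg (B + (AddSubmonoid.closure t : Set M))) :
    IsRationalSeries (degSeries deg ((B + (AddSubmonoid.closure t : Set M)) \ T)) := by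
  induction t, ht using Set.Finite.induction_on generalizing T with
  | empty =>
    exact isRationalSeries_degSeries_of_finite deg (hB.subset fun x hx => by simpa using hx.1)
  | @insert u t _ ht ih =>
    obtain ⟨J, hJ⟩ := exists_sdiff_colon_succ_eq hB (ht.insert u) hT (mem_insert u t)
    have hS := add_closure_insert_eq B t u
    set S := B + (AddSubmonoid.closure (insert u t) : Set M)
    simp only [mem_insert_iff, forall_eq_or_imp] at hT hpos
    have hSt : ∀ v ∈ t, ∀ x ∈ S, v + x ∈ S := by
      rintro v hv _ ⟨b, hb, q, hq, rfl⟩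
      exact ⟨b, hb, v + q, add_mem (AddSubmonoid.subset_closure (mem_insert_of_mem u hv)) hq,
        add_left_comm b v q⟩
    have hrest (k : ℕ) : IsRationalSeries (degSeries deg
        ((B + (AddSubmonoid.closure t : Set M)) \ ({x | k • u + x ∈ T} ∪ (u +ᵥ S)))) := by
      refine ih hpos.2 ?_ (hfin.mono (hS ▸ subset_union_left))
      rintro v hv x (hx | ⟨y, hy, rfl⟩)
      · exact Or.inl (by simpa only [mem_ofPred_eq, add_left_comm] using hT.2 v hv _ hx)
      · exact Or.inr ⟨v + y, hSt v hv y hy, add_left_comm u v y⟩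
    have hstep (k : ℕ) := degSeries_sdiff_eq_add_X_pow_mul hS
      (hfin.mono (sdiff_subset (s := S) (t := {x | k • u + x ∈ T})))
    simpa only [zero_nsmul, zero_add, ofPred_mem_eq] using
      IsRationalSeries.of_forall_eq_add_X_pow_mul
        (F := fun k => degSeries deg (S \ {x | k • u + x ∈ T})) hpos.1 hrest
        (fun k => by simpa only [mem_ofPred_eq, succ_nsmul, add_assoc] using hstep k)
        (congrArg (degSeries deg) hJ)

/-- A set is positively periodic if it is a finite union of translates of one finitely generated
submonoid whose nonzero elements have nonzero degree. -/
def IsPositivelyPeriodic (deg : M →+ ℕ) (s : Set M) : Prop :=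
  ∃ (B : Set M) (Q : AddSubmonoid M), B.Finite ∧ Q.FG ∧ (∀ q ∈ Q, deg q = 0 → q = 0) ∧
    s = B + Q

namespace IsPositivelyPeriodic

variable [IsCancelAdd M] {s s' : Set M}

theorem inter (hs : IsPositivelyPeriodic deg s) (hs' : IsPositivelyPeriodic deg s') :
    IsPositivelyPeriodic deg (s ∩ s') := by
  obtain ⟨B, Q, hB, hQ, hpos, rfl⟩ := hs
  obtain ⟨B', Q', hB', hQ', -, rfl⟩ := hs'
  obtain ⟨F, hF, hinter⟩ := exists_finite_add_inter_add_eq hB hB' hQ hQ'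
  exact ⟨F, Q ⊓ Q', hF, fg_inf hQ hQ', fun q hq => hpos q hq.1, hinter⟩

theorem isRationalSeries_degSeries (hs : IsPositivelyPeriodic deg s) (hfin : GradedFinite deg s) :
    IsRationalSeries (degSeries deg s) := by
  obtain ⟨B, Q, hB, hQ, hpos, rfl⟩ := hs
  obtain ⟨t, rfl, ht⟩ := (AddSubmonoid.fg_iff _).1 hQ
  rw [← AddSubmonoid.closure_sdiff_singleton_zero t] at hfin ⊢
  have hne : ∀ u ∈ t \ {0}, deg u ≠ 0 := fun u hu h0 =>
    hu.2 (hpos u (AddSubmonoid.subset_closure hu.1) h0)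
  simpa only [sdiff_empty] using
    isRationalSeries_degSeries_add_closure_sdiff (T := ∅) hB ht.sdiff hne (by simp) hfin

end IsPositivelyPeriodic

theorem eq_zero_of_mem_closure_of_map_eq_zero {t : Set M} (ht : ∀ u ∈ t, deg u ≠ 0) {x : M}
    (hx : x ∈ AddSubmonoid.closure t) (h0 : deg x = 0) : x = 0 := by
  induction hx using AddSubmonoid.closure_induction with
  | mem u hu => exact absurd h0 (ht u hu)
  | zero => rfl
  | add x y _ _ ihx ihy =>
    obtain ⟨hx, hy⟩ := add_eq_zero.1 ((map_add deg x y).symm.trans h0)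
    rw [ihx hx, ihy hy, add_zero]

/-- The periods of degree zero only produce finitely many elements, all of the degree of the base
point, so they can be absorbed into the finite set of base points. -/
theorem isPositivelyPeriodic_of_isLinearSet {s : Set M} (hs : IsLinearSet s)
    (hfin : GradedFinite deg s) : IsPositivelyPeriodic deg s := by
  obtain ⟨a, t, ht, rfl⟩ := hs
  let t₀ := {u ∈ t | deg u = 0}
  have hle : AddSubmonoid.closure t₀ ≤ AddMonoidHom.mker deg :=
    AddSubmonoid.closure_le.2 fun u hu => hu.2
  refine ⟨a +ᵥ (AddSubmonoid.closure t₀ : Set M), AddSubmonoid.closure (t \ t₀), ?_,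
    (AddSubmonoid.fg_iff _).2 ⟨_, rfl, ht.sdiff⟩,
    fun q => eq_zero_of_mem_closure_of_map_eq_zero fun u hu h0 => hu.2 ⟨hu.1, h0⟩, ?_⟩
  · refine (hfin (deg a)).subset ?_
    rintro _ ⟨x, hx, rfl⟩
    refine ⟨⟨x, AddSubmonoid.closure_mono (sep_subset t _) hx, rfl⟩, ?_⟩
    have hx0 : deg x = 0 := hle hx
    simp [hx0]
  · rw [vadd_add_assoc, ← AddSubmonoid.coe_sup, ← AddSubmonoid.closure_union,
      union_sdiff_cancel (sep_subset t _)]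

theorem isRationalSeries_degSeries_of_isSemilinearSet [IsCancelAdd M] {s : Set M}
    (hs : IsSemilinearSet s) (hfin : GradedFinite deg s) : IsRationalSeries (degSeries deg s) := by
  obtain ⟨S, hS, rfl⟩ := isSemilinearSet_iff.1 hs
  rw [sUnion_eq_biUnion] at hfin ⊢
  refine isRationalSeries_degSeries_biUnion (C := {s | IsPositivelyPeriodic deg s})
    (fun s hs t ht => hs.inter ht) (fun s hs => hs.isRationalSeries_degSeries) S
    (fun s hs => ?_) hfin
  exact isPositivelyPeriodic_of_isLinearSet (hS s hs)
    (hfin.mono (subset_biUnion_of_mem (u := fun s => s) hs))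

end Rationality

section Runs

variable {M V : Type*} [AddCommMonoid M] {lab : V → V → Set M} {fin : V → Set M} {T T' : Set V}

/-- `IsRunSum lab fin T i x` says that `x` is the sum of the labels along some run of the automaton
with transition labels `lab` and final labels `fin` that starts in the state `i`. Every state it
enters after `i` lies in `T`; there is no such restriction on `i` itself. -/
inductive IsRunSum (lab : V → V → Set M) (fin : V → Set M) (T : Set V) : V → M → Prop
  | final {i x} : x ∈ fin i → IsRunSum lab fin T i x
  | step {i k x y} : x ∈ lab i k → k ∈ T → IsRunSum lab fin T k y → IsRunSum lab fin T i (x + y)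

namespace IsRunSum

variable {i v : V} {x y : M}

theorem mono (hTT' : T ⊆ T') (h : IsRunSum lab fin T i x) : IsRunSum lab fin T' i x := by
  induction h with
  | final hx => exact .final hx
  | step hx hk _ ih => exact .step hx (hTT' hk) ih

theorem append (hTT' : T ⊆ T') (hv : v ∈ T') (hx : IsRunSum lab (fun k => lab k v) T i x)
    (hy : IsRunSum lab fin T' v y) : IsRunSum lab fin T' i (x + y) := by
  induction hx with
  | final hx => exact .step hx hv hy
  | step hx hk _ ih => exact add_assoc _ _ y ▸ .step hx (hTT' hk) ih

/-- Kleene's decomposition of a run at its visits to `v`. Since addition is commutative, the sums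
over the loops at `v` form the submonoid generated by the sums over the loops that return to `v`
only once. -/
theorem setOf_insert_eq (lab : V → V → Set M) (fin : V → Set M) (v : V) (T : Set V) (i : V) :
    {x | IsRunSum lab fin (insert v T) i x} = {x | IsRunSum lab fin T i x} ∪
      ({x | IsRunSum lab (fun k => lab k v) T i x} +
        ((AddSubmonoid.closure {x | IsRunSum lab (fun k => lab k v) T v x} : Set M) +
          {x | IsRunSum lab fin T v x})) := by
  have hT := subset_insert v T
  have hv := mem_insert v T
  refine Subset.antisymm (fun x hx => ?_) (union_subset (fun x hx => hx.mono hT) ?_)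
  · induction hx with
    | final hx => exact Or.inl (.final hx)
    | @step i k x y hx hk _ ih =>
      rcases hk with rfl | hk
      · refine Or.inr ⟨x, .final hx, y, ?_, rfl⟩
        rcases ih with hy | ⟨a, ha, _, ⟨c, hc, b, hb, rfl⟩, rfl⟩
        · exact ⟨0, zero_mem _, y, hy, zero_add y⟩
        · exact ⟨a + c, add_mem (AddSubmonoid.subset_closure ha) hc, b, hb, add_assoc a c b⟩
      · rcases ih with hy | ⟨a, ha, z, hz, rfl⟩
        · exact Or.inl (step hx hk hy)
        · exact Or.inr ⟨x + a, step hx hk ha, z, hz, add_assoc x a z⟩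
  · rintro _ ⟨a, ha, _, ⟨c, hc, b, hb, rfl⟩, rfl⟩
    refine append hT hv ha ?_
    change IsRunSum lab fin (insert v T) v (c + b)
    induction hc using AddSubmonoid.closure_induction_left with
    | zero => exact (zero_add b).symm ▸ mono hT hb
    | add_left a ha c _ ih => exact (add_assoc a c b).symm ▸ append hT hv ha ih

theorem isSemilinearSet (hT : T.Finite) (hlab : ∀ i k, IsSemilinearSet (lab i k))
    (hfin : ∀ i, IsSemilinearSet (fin i)) (i : V) :
    IsSemilinearSet {x | IsRunSum lab fin T i x} := by
  induction T, hT using Set.Finite.induction_on generalizing fin i with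
  | empty =>
    have h : {x | IsRunSum lab fin ∅ i x} = fin i := by
      ext x
      refine ⟨fun hx => ?_, .final⟩
      cases hx with
      | final hx => exact hx
      | step _ hk => exact hk.elim
    exact h ▸ hfin i
  | @insert v T _ _ ih =>
    rw [setOf_insert_eq]
    have hloop (j : V) := ih (fun k => hlab k v) j
    exact (ih hfin i).union ((hloop i).add ((hloop v).closure.add (ih hfin v)))

end IsRunSum

end Runs

section Semilinear

variable {N : Type*} [AddCommMonoid N]

theorem isSemilinearSet_setOf_isLeast [IsCancelAdd N] {X : Set (N × ℕ)} (hX : IsSemilinearSet X) :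
    IsSemilinearSet {x : N × ℕ | IsLeast {n | (x.1, n) ∈ X} x.2} := by
  have hup : IsSemilinearSet (X + AddMonoidHom.inr N ℕ '' ((1 : ℕ) +ᵥ univ)) :=
    hX.add (((IsSemilinearSet.univ (M := ℕ)).vadd 1).image _)
  convert hX.sdiff hup using 1
  ext ⟨a, n⟩
  refine and_congr_right fun _ => ⟨fun hmin => ?_, fun hn m hm => ?_⟩
  · rintro ⟨⟨b, m⟩, hm, _, ⟨_, ⟨k, -, rfl⟩, rfl⟩, h⟩
    simp only [AddMonoidHom.inr_apply, Prod.mk_add_mk, add_zero, Prod.mk.injEq, vadd_eq_add] at h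
    obtain ⟨rfl, rfl⟩ := h
    have := hmin hm
    omega
  · by_contra hlt
    exact hn ⟨(a, m), hm, _, ⟨_, ⟨n - m - 1, trivial, rfl⟩, rfl⟩, Prod.ext (by simp) (by
      simp only [AddMonoidHom.inr_apply, vadd_eq_add, Prod.mk_add_mk]
      omega)⟩

theorem isSemilinearSet_setOf_mul_mem {A G : Type*} [CommGroup A] [Group.FG A] [Group G]
    (ι : A →* G) (g : G) (H : Subgroup G) :
    IsSemilinearSet {a : Additive A | g * ι a.toMul ∈ H} := by
  rcases eq_empty_or_nonempty {a : Additive A | g * ι a.toMul ∈ H} with h | ⟨a₀, ha₀⟩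
  · exact h ▸ IsSemilinearSet.empty
  · have hpre := (IsSemilinearSet.singleton (Additive.ofMul (a₀.toMul : A ⧸ H.comap ι))).preimage
      (QuotientGroup.mk' (H.comap ι)).toAdditive
    convert hpre using 1
    ext a
    have hcoset : a ∈ (QuotientGroup.mk' (H.comap ι)).toAdditive ⁻¹'
        {Additive.ofMul (a₀.toMul : A ⧸ H.comap ι)} ↔
          (a₀.toMul : A ⧸ H.comap ι) = (a.toMul : A ⧸ H.comap ι) := eq_comm
    rw [hcoset, QuotientGroup.eq, Subgroup.mem_comap, map_mul, map_inv,
      ← H.mul_mem_cancel_left ha₀, mem_ofPred_eq]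
    group

end Semilinear

section Words

@[simp]
theorem wordWeight_cons {G : Type*} {S : Finset G} (ω : S → ℕ+) (s : S) (w : List S) :
    wordWeight ω (s :: w) = ω s + wordWeight ω w := by
  simp [wordWeight]

variable {G : Type*} [Group G] {S : Finset G}

@[simp]
theorem wordEval_cons (s : S) (w : List S) : wordEval (s :: w) = s * wordEval w := by
  simp [wordEval]

theorem isLeast_weight (hS : Submonoid.closure (S : Set G) = ⊤) (ω : S → ℕ+) (g : G) :
    IsLeast {m | ∃ w : List S, wordEval w = g ∧ wordWeight ω w = m} (weight ω g) :=
  ⟨exists_word_weight hS ω g, fun _ hm => Nat.sInf_le hm⟩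

theorem gradedFinite_weight (hS : Submonoid.closure (S : Set G) = ⊤) (ω : S → ℕ+)
    (H : Subgroup G) : GradedFinite (weight ω) (H : Set G) :=
  finite_sphere hS ω H

end Words

section Cosets

open scoped IsMulCommutative

variable {G : Type*} [Group G] {S : Finset G} (ω : S → ℕ+) (A : Subgroup G)

theorem injective_out_mul (i : G ⧸ A) :
    Function.Injective fun a : Additive A => i.out * (a.toMul : G) := fun _ _ h =>
  Additive.toMul.injective (Subtype.ext (mul_left_cancel h))

theorem exists_eq_out_mul (g : G) : ∃ a : Additive A, g = (g : G ⧸ A).out * (a.toMul : G) :=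
  ⟨Additive.ofMul ⟨_, QuotientGroup.eq.1 (QuotientGroup.out_eq' (g : G ⧸ A))⟩, by simp⟩

/-- The transition labels of the coset automaton, whose state is the coset containing the value of
the unread part of the word. If `w` has the value `k.out * b`, then `s :: w` has the value
`i.out * (a * b)`, where `(a, ω s)` is the label of the letter `s` from `i` to `k`. -/
def transitionLabel (i k : G ⧸ A) : Set (Additive A × ℕ) :=
  {x | ∃ s : S, (s : G) * k.out = i.out * (x.1.toMul : G) ∧ ω s = x.2}

/-- The final labels of the coset automaton, which account for the empty word. -/
def finalLabel (i : G ⧸ A) : Set (Additive A × ℕ) :=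
  {x | 1 = i.out * (x.1.toMul : G) ∧ 0 = x.2}

theorem finite_setOf_eq_out_mul (i : G ⧸ A) (g : G) (n : ℕ) :
    {x : Additive A × ℕ | g = i.out * (x.1.toMul : G) ∧ n = x.2}.Finite :=
  Set.Subsingleton.finite fun _ hx _ hy =>
    Prod.ext (injective_out_mul A i (hx.1.symm.trans hy.1)) (hx.2.symm.trans hy.2)

theorem finite_transitionLabel (i k : G ⧸ A) : (transitionLabel ω A i k).Finite := by
  simp only [transitionLabel, ofPred_exists]
  exact finite_iUnion fun s => finite_setOf_eq_out_mul A i (s * k.out) (ω s)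

variable [IsMulCommutative A]

theorem isRunSum_transitionLabel_iff (i : G ⧸ A) (x : Additive A × ℕ) :
    IsRunSum (transitionLabel ω A) (finalLabel A) univ i x ↔
      ∃ w : List S, wordEval w = i.out * (x.1.toMul : G) ∧ wordWeight ω w = x.2 := by
  constructor
  · intro h
    induction h with
    | final hx => exact ⟨[], hx⟩
    | @step i k x y hx _ _ ih =>
      obtain ⟨s, hs, hsω⟩ := hx
      obtain ⟨w, hw, hwω⟩ := ih
      refine ⟨s :: w, ?_, by simp [hsω, hwω]⟩
      simp [hw, ← mul_assoc, hs]
  · rintro ⟨w, hw, hwω⟩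
    induction w generalizing i x with
    | nil => exact .final ⟨hw, hwω⟩
    | cons s w ih =>
      obtain ⟨a, ha⟩ := exists_eq_out_mul A (wordEval w)
      have hx : x = (x.1 - a, (ω s : ℕ)) + (a, wordWeight ω w) :=
        Prod.ext (by simp) (by simpa using hwω.symm)
      rw [hx]
      refine .step ⟨s, ?_, rfl⟩ (mem_univ ((wordEval w : G) : G ⧸ A)) (ih _ _ ha rfl)
      rw [wordEval_cons, ha, ← mul_assoc] at hw
      simp [eq_mul_inv_of_mul_eq hw, mul_assoc, div_eq_mul_inv]

variable [A.FiniteIndex]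

theorem isSemilinearSet_setOf_weight_eq (hS : Submonoid.closure (S : Set G) = ⊤) (i : G ⧸ A) :
    IsSemilinearSet {x : Additive A × ℕ | weight ω (i.out * (x.1.toMul : G)) = x.2} := by
  have hrun := IsRunSum.isSemilinearSet (fin := finalLabel A) (toFinite univ)
    (fun i k => IsSemilinearSet.of_finite (finite_transitionLabel ω A i k))
    (fun i => IsSemilinearSet.of_finite (finite_setOf_eq_out_mul A i 1 0)) i
  convert isSemilinearSet_setOf_isLeast hrun using 1
  ext x
  have hleast := isLeast_weight hS ω (i.out * (x.1.toMul : G))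
  simp only [mem_ofPred_eq, isRunSum_transitionLabel_iff]
  exact ⟨fun h => h ▸ hleast, hleast.unique⟩

/-- The graph of the weight function on the part of `H` in the coset `i`, parametrised by `A`. -/
def weightGraph (H : Subgroup G) (i : G ⧸ A) : Set (Additive A × ℕ) :=
  {x | i.out * (x.1.toMul : G) ∈ H ∧ weight ω (i.out * (x.1.toMul : G)) = x.2}

theorem isSemilinearSet_weightGraph (hS : Submonoid.closure (S : Set G) = ⊤) (H : Subgroup G)
    (i : G ⧸ A) : IsSemilinearSet (weightGraph ω A H i) := by
  have : Group.FG G := Group.fg_iff_monoid_fg.2 ⟨S, hS⟩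
  have := Subgroup.fg_of_index_ne_zero A
  exact ((isSemilinearSet_setOf_mul_mem A.subtype i.out H).preimage
    (AddMonoidHom.fst (Additive A) ℕ)).inter (isSemilinearSet_setOf_weight_eq ω A hS i)

theorem isRationalSeries_degSeries_weight_coset (hS : Submonoid.closure (S : Set G) = ⊤)
    (H : Subgroup G) (i : G ⧸ A) :
    IsRationalSeries (degSeries (weight ω) {h ∈ (H : Set G) | (h : G ⧸ A) = i}) := by
  have hinj : InjOn (fun x : Additive A × ℕ => i.out * (x.1.toMul : G)) (weightGraph ω A H i) :=
    fun x hx y hy h =>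
    Prod.ext (injective_out_mul A i h) (hx.2.symm.trans ((congrArg (weight ω) h).trans hy.2))
  have himage : {h ∈ (H : Set G) | (h : G ⧸ A) = i} =
      (fun x => i.out * (x.1.toMul : G)) '' weightGraph ω A H i := by
    ext h
    constructor
    · rintro ⟨hh, rfl⟩
      obtain ⟨a, ha⟩ := exists_eq_out_mul A h
      refine ⟨(a, weight ω h), ⟨?_, ?_⟩, ha.symm⟩
      · simpa only [← ha, SetLike.mem_coe] using hh
      · simp only [← ha]
    · rintro ⟨x, hx, rfl⟩
      exact ⟨hx.1, by simp⟩
  rw [himage, degSeries_image (deg := AddMonoidHom.snd (Additive A) ℕ) 0 hinj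
    fun x hx => by simpa using hx.2, pow_zero, one_mul]
  exact isRationalSeries_degSeries_of_isSemilinearSet (isSemilinearSet_weightGraph ω A hS H i)
    ((gradedFinite_weight hS ω H).of_injOn hinj (fun x hx => hx.1) fun x hx => hx.2)

end Cosets

end RelGrowth

theorem theoremA {G : Type*} [Group G] (hG : RelGrowth.IsVirtuallyAbelian G)
    (S : Finset G) (hS : Submonoid.closure (S : Set G) = ⊤) (ω : S → ℕ+) (H : Subgroup G) :
    RelGrowth.IsRationalSeries (RelGrowth.relGrowthSeries ω H) := by
  obtain ⟨A, _, _⟩ := hG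
  exact RelGrowth.isRationalSeries_degSeries_of_forall_fiber (QuotientGroup.mk : G → G ⧸ A)
    (RelGrowth.gradedFinite_weight hS ω H)
    (RelGrowth.isRationalSeries_degSeries_weight_coset ω A hS H)
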